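/- Let $\mathcal G=(\mathcal V,\mathcal E)$ be a finite directed graph, $d,F\in\{0,1,2,\dots\}$, and let $\mathcal N_i^-=\{j:(j,i)\in\mathcal E\}$ be the in-neighbours of $i$. Let $\mathcal A\subseteq\mathcal V$ be the set of Byzantine nodes and $\mathcal R=\mathcal V\setminus\mathcal A$ the set of regular nodes. A set $S\subseteq\mathcal V$ is $r$-reachable if some $i\in S$ satisfies $|\mathcal N_i^-\setminus S|\ge r$, and $\mathcal G$ is $r$-robust if for any two disjoint nonempty sets of nodes at least one is $r$-reachable. Let $f_i:\mathbb R^d\to\mathbb R$ ($i\in\mathcal V$) be convex, $\hat x\in\mathbb R^d$, and $(\eta[k])_{k\ge0}$ real step-sizes. Distance-MinMax filtering dynamics: each $i\in\mathcal R$ starts at a minimizer $x_i[0]$ of $f_i$. At each step $k=0,1,2,\dots$ every node $i\in\mathcal R$ holds its own state $x_i[k]$ and one vector from each $j\in\mathcal N_i^-\setminus\{i\}$: the state $x_j[k]$ if $j$ is regular, and an arbitrary vector, possibly different for different receivers, if $j$ is Byzantine. Then $i$ 1. removes, among the vectors received from the nodes other than $i$, the $F$ vectors furthest from $\hat x$ in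 Euclidean norm; 2. among the remaining received vectors, removes each one which, in some component $p\in\{1,\dots,d\}$, is among the $F$ highest or among the $F$ lowest values of that component (here and in 1, vectors are counted by sender, ties may be broken in any way, and all vectors count as selected if there are fewer than $F$); 3. lets $z_i[k]$ be the average of the remaining vectors and its own state $x_i[k]$ (which is never removed); 4. sets $x_i[k+1]=z_i[k]-\eta[k]\,g_i[k]$ for some subgradient $g_i[k]\in\partial f_i(z_i[k])$. Theorem. Suppose that - there is $L>0$ such that $\|g\|_2\le L$ for all $i\in\mathcal V$, $x\in\mathbb R^d$ and $g\in\partial f_i(x)$; - $\eta[k]\to0$, $\eta[k+1]<\eta[k]$ for all $k$, and $\sum_{k=0}^\infty\eta[k]=\infty$; - $\mathcal G$ is $((2d+1)F+1)$-robust, and $|\mathcal N_i^-\cap\mathcal A|\le F$ for all $i\in\mathcal R$. Then, whatever the Byzantine nodes send, $\lim_{k\to\infty}\|x_i[k]-x_j[k]\|_2=0$ for all $i,j\in\mathcal R$. -/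

import Mathlib

open Filter Topology

namespace ResilientOpt

variable {V : Type*} [Fintype V] [DecidableEq V] {d : ℕ}

/-- `g` is a subgradient of `f` at `x`, that is, `g ∈ ∂f(x)`. -/
def IsSubgradient (f : EuclideanSpace ℝ (Fin d) → ℝ) (x g : EuclideanSpace ℝ (Fin d)) : Prop :=
  ∀ y, f x + inner ℝ g (y - x) ≤ f y

open Classical in
/-- The in-neighbours of `i`: the nodes `j` with an edge `(j, i)`. -/
noncomputable def inNeighbors (G : Digraph V) (i : V) : Finset V :=
  Finset.univ.filter fun j => G.Adj j i

/-- `S` contains a node that has at least `r` in-neighbours outside `S`. -/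
def IsReachable (G : Digraph V) (r : ℕ) (S : Finset V) : Prop :=
  ∃ i ∈ S, r ≤ (inNeighbors G i \ S).card

/-- `G` is `r`-robust. -/
def IsRobust (G : Digraph V) (r : ℕ) : Prop :=
  ∀ S₁ S₂ : Finset V, S₁.Nonempty → S₂.Nonempty → Disjoint S₁ S₂ →
    IsReachable G r S₁ ∨ IsReachable G r S₂

/-- Every node outside `A` (every regular node) has at most `F` in-neighbours in `A`. -/
def IsLocalSet (G : Digraph V) (F : ℕ) (A : Finset V) : Prop :=
  ∀ i ∉ A, (inNeighbors G i ∩ A).card ≤ F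

/-- `H` consists of `F` nodes of `T` (all nodes of `T` if there are fewer than `F`)
at which `val` is highest; ties may be broken in any way. -/
def IsHighest (F : ℕ) (T : Finset V) (val : V → ℝ) (H : Finset V) : Prop :=
  H ⊆ T ∧ H.card = min F T.card ∧ ∀ a ∈ H, ∀ b ∈ T \ H, val b ≤ val a

/-- `H` consists of `F` nodes of `T` (all nodes of `T` if there are fewer than `F`)
at which `val` is lowest; ties may be broken in any way. -/
def IsLowest (F : ℕ) (T : Finset V) (val : V → ℝ) (H : Finset V) : Prop :=
  H ⊆ T ∧ H.card = min F T.card ∧ ∀ a ∈ H, ∀ b ∈ T \ H, val a ≤ val b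

/-- `D` is a possible result of the distance filter of node `i` on the nodes `S`, where `y j` is
the vector that `i` holds from `j`: the `F` nodes other than `i` whose vectors are furthest from
the auxiliary point `xhat` are removed. -/
def IsDistFilter (F : ℕ) (xhat : EuclideanSpace ℝ (Fin d)) (y : V → EuclideanSpace ℝ (Fin d))
    (i : V) (S D : Finset V) : Prop :=
  ∃ H : Finset V, IsHighest F (S.erase i) (fun j => ‖y j - xhat‖) H ∧ D = S \ H

/-- `M` is a possible result of the min-max filter of node `i` on the nodes `D`: a node other than
`i` is removed if in some component `p` it is among the `F` highest or among the `F` lowest. -/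
def IsMinMaxFilter (F : ℕ) (y : V → EuclideanSpace ℝ (Fin d)) (i : V) (D M : Finset V) : Prop :=
  ∃ Hi Lo : Fin d → Finset V,
    (∀ p, IsHighest F (D.erase i) (fun j => y j p) (Hi p)) ∧
    (∀ p, IsLowest F (D.erase i) (fun j => y j p) (Lo p)) ∧
    M = D \ Finset.univ.biUnion fun p => Hi p ∪ Lo p

/-- The average of the vectors `y j` over the nodes `j ∈ M`. -/
noncomputable def average (y : V → EuclideanSpace ℝ (Fin d)) (M : Finset V) :
    EuclideanSpace ℝ (Fin d) :=
  ∑ j ∈ M, (1 / (M.card : ℝ)) • y j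

/-- `x k i` is the state of node `i` at time-step `k` in an execution of the
distance-min-max filtering dynamics with Byzantine set `A`, and `msg k i j` is the vector that
node `i` holds from node `j` at time-step `k`. Regular nodes send their state to all out-neighbours;
the vectors `msg k i j` with `j ∈ A` are unconstrained and may differ from receiver to receiver. -/
structure IsExecution (G : Digraph V) (A : Finset V) (F : ℕ)
    (f : V → EuclideanSpace ℝ (Fin d) → ℝ) (η : ℕ → ℝ) (xhat : EuclideanSpace ℝ (Fin d))
    (x : ℕ → V → EuclideanSpace ℝ (Fin d)) (msg : ℕ → V → V → EuclideanSpace ℝ (Fin d)) :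
    Prop where
  /-- Each regular node starts at a minimizer of its own function. -/
  init : ∀ i ∉ A, IsMinOn (f i) Set.univ (x 0 i)
  /-- A regular node sends its current state to its out-neighbours (and knows its own state). -/
  broadcast : ∀ k, ∀ i ∉ A, ∀ j ∉ A, j ∈ insert i (inNeighbors G i) → msg k i j = x k j
  /-- Distance filter, min-max filter, average, and subgradient step. -/
  update : ∀ k, ∀ i ∉ A, ∃ (D M : Finset V) (z g : EuclideanSpace ℝ (Fin d)),
    IsDistFilter F xhat (msg k i) i (insert i (inNeighbors G i)) D ∧
    IsMinMaxFilter F (msg k i) i D M ∧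
    z = average (msg k i) M ∧
    IsSubgradient (f i) z g ∧
    x (k + 1) i = z - η k • g

end ResilientOpt

namespace ResilientOpt

/-! ### Counting survivors of the filters -/

section Filtering

variable {V : Type*} [DecidableEq V] {F : ℕ} {val : V → ℝ}

/-! Each coordinate is treated separately; its spread over the regular nodes contracts every `n =
Fintype.card V` steps, up to an error of order `η k`, which vanishes. Trimming the `F` extreme
values keeps every averaged value within the regular range, even if Byzantine ones survive. The
distance filter and the `2 * d` trims delete at most `(2 * d + 1) * F` nodes, so among `(2 * d + 1)
* F + 1` in-neighbours some survivor remains, and `exists_survivor_le` makes it respect the bound on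
their regular values. It enters the average with weight at least `1 / n` and pulls the node away
from the extreme (`IsExecution.step_le`). In `IsExecution.top_add_top_le`, the nodes near the
maximum and those near the minimum form disjoint shrinking sets. By robustness one of them loses a
node at each step while both are nonempty, so within `n` steps one is empty and that extreme has
moved inwards. -/

theorem IsHighest.card_le {T H : Finset V} (h : IsHighest F T val H) : H.card ≤ F :=
  h.2.1.trans_le (min_le_left _ _)

theorem IsLowest.isHighest_neg {T H : Finset V} (h : IsLowest F T val H) :
    IsHighest F T (fun j => -val j) H :=
  ⟨h.1, h.2.1, fun a ha b hb => neg_le_neg (h.2.2 a ha b hb)⟩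

/-- If `T` contains at most `F` nodes of `A`, then a node that is not removed from `T` has a value
at most the maximum over the nodes outside `A`. -/
theorem IsHighest.le_of_notMem {T H A : Finset V} (h : IsHighest F T val H)
    (hA : (T ∩ A).card ≤ F) {U : ℝ} (hU : ∀ j ∈ T, j ∉ A → val j ≤ U) {j : V} (hjT : j ∈ T)
    (hjH : j ∉ H) : val j ≤ U := by
  by_cases hjA : j ∈ A
  swap
  · exact hU j hjT hjA
  have hlt : H.card < T.card :=
    Finset.card_lt_card ⟨h.1, fun hs => hjH (hs hjT)⟩
  have hcard : H.card = F := by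
    have := h.2.1
    omega
  obtain ⟨a, haH, haA⟩ : ∃ a ∈ H, a ∉ A := by
    -- Otherwise the `F` nodes of `H` together with `j` are `F + 1` nodes of `A` in `T`.
    by_contra! hsub
    have hins : insert j H ⊆ T ∩ A := by
      intro a ha
      rcases Finset.mem_insert.1 ha with rfl | ha
      · exact Finset.mem_inter.2 ⟨hjT, hjA⟩
      · exact Finset.mem_inter.2 ⟨h.1 ha, hsub a ha⟩
    have := Finset.card_le_card hins
    rw [Finset.card_insert_of_notMem hjH] at this
    omega
  exact (h.2.2 a haH j (Finset.mem_sdiff.2 ⟨hjT, hjH⟩)).trans (hU a (h.1 haH) haA)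

/-- Among sufficiently many nodes whose values, outside `A`, are at most `T`, some node with value
at most `T` survives the removal of `H` and of the sets `W c`. -/
theorem exists_survivor_le {ι : Type*} [Fintype ι] [DecidableEq ι] {N H P A : Finset V}
    {W : ι → Finset V} {q : ι} (hH : H.card ≤ F) (hW : ∀ c, (W c).card ≤ F)
    (hq : IsHighest F (N \ H) val (W q)) (hPN : P ⊆ N) (hPA : (P ∩ A).card ≤ F)
    (hP : (Fintype.card ι + 1) * F + 1 ≤ P.card) {T : ℝ} (hT : ∀ j ∈ P, j ∉ A → val j ≤ T) :
    ∃ j ∈ (N \ H) \ Finset.univ.biUnion W, val j ≤ T := by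
  have hall : (Finset.univ.biUnion W).card ≤ Fintype.card ι * F :=
    Finset.card_biUnion_le_card_mul _ _ _ fun c _ => hW c
  have hrest : ((Finset.univ.erase q).biUnion W).card + F ≤ Fintype.card ι * F := by
    have h1 := Finset.card_biUnion_le_card_mul (Finset.univ.erase q) W F fun c _ => hW c
    have h2 := Finset.card_erase_add_one (Finset.mem_univ q)
    rw [Finset.card_univ] at h2
    rw [← h2, add_mul, one_mul]
    omega
  -- If the trim `W q` removes a regular node of `P`, its value dominates every survivor, Byzantine
  -- or not. Otherwise `W q` costs `P \ A` nothing, which offsets the up to `F` Byzantine nodes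
  -- discarded from `P`, and a regular node survives.
  by_cases hex : ∃ j ∈ P, j ∉ A ∧ j ∈ W q
  · obtain ⟨a, haP, haA, haW⟩ := hex
    obtain ⟨s, hsP, hs⟩ : ∃ s ∈ P, s ∉ H ∪ Finset.univ.biUnion W := by
      apply Finset.exists_mem_notMem_of_card_lt_card
      have := Finset.card_union_le H (Finset.univ.biUnion W)
      rw [add_mul, one_mul] at hP
      omega
    rw [Finset.mem_union, not_or] at hs
    have hsD : s ∈ N \ H := Finset.mem_sdiff.2 ⟨hPN hsP, hs.1⟩
    refine ⟨s, Finset.mem_sdiff.2 ⟨hsD, hs.2⟩, ?_⟩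
    have hsq : s ∉ W q := fun h => hs.2 (Finset.mem_biUnion.2 ⟨q, Finset.mem_univ q, h⟩)
    exact (hq.2.2 a haW s (Finset.mem_sdiff.2 ⟨hsD, hsq⟩)).trans (hT a haP haA)
  · push Not at hex
    obtain ⟨s, hsP, hs⟩ : ∃ s ∈ P \ A, s ∉ H ∪ (Finset.univ.erase q).biUnion W := by
      apply Finset.exists_mem_notMem_of_card_lt_card
      have h1 := Finset.card_union_le H ((Finset.univ.erase q).biUnion W)
      have h2 := Finset.card_sdiff_add_card_inter P A
      rw [add_mul, one_mul] at hP
      omega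
    rw [Finset.mem_union, not_or] at hs
    obtain ⟨hsP, hsA⟩ := Finset.mem_sdiff.1 hsP
    refine ⟨s, Finset.mem_sdiff.2 ⟨Finset.mem_sdiff.2 ⟨hPN hsP, hs.1⟩, fun h => ?_⟩,
      hT s hsP hsA⟩
    obtain ⟨c, -, hc⟩ := Finset.mem_biUnion.1 h
    have hcq : c ≠ q := by
      rintro rfl
      exact hex s hsP hsA hc
    exact hs.2 (Finset.mem_biUnion.2 ⟨c, Finset.mem_erase.2 ⟨hcq, Finset.mem_univ c⟩, hc⟩)

end Filtering

/-! ### Signed components and averages -/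

/-- The sign `1` for `true` and `-1` for `false`. -/
def signOf (b : Bool) : ℝ := if b then 1 else -1

/-- The lowest values are the highest after negation, so upper bounds on signed components suffice
throughout. The index type has `2 * d` elements, one per trim. -/
theorem IsMinMaxFilter.exists_isHighest {V : Type*} [DecidableEq V] {d F : ℕ}
    {y : V → EuclideanSpace ℝ (Fin d)} {i : V} {D M : Finset V}
    (h : IsMinMaxFilter F y i D M) :
    ∃ W : Bool × Fin d → Finset V,
      (∀ b p, IsHighest F (D.erase i) (fun j => signOf b * y j p) (W (b, p))) ∧
      M = D \ Finset.univ.biUnion W := by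
  obtain ⟨Hi, Lo, hHi, hLo, rfl⟩ := h
  refine ⟨fun c => if c.1 then Hi c.2 else Lo c.2, ?_, ?_⟩
  · rintro (_ | _) p
    · simpa [signOf] using (hLo p).isHighest_neg
    · simpa [signOf] using hHi p
  · congr 1
    ext j
    simp only [Finset.mem_biUnion, Finset.mem_univ, true_and, Finset.mem_union, Prod.exists,
      Bool.exists_bool, if_true, Bool.false_eq_true, if_false]
    rw [← exists_or]
    simp only [or_comm]

/-- An average of numbers at most `U`, one of which is at most `T`. -/
theorem sum_div_card_le {V : Type*} [Fintype V] {M : Finset V} {val : V → ℝ} {U T : ℝ}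
    (hU : ∀ j ∈ M, val j ≤ U) (hTU : T ≤ U) {s : V} (hs : s ∈ M) (hT : val s ≤ T) :
    ∑ j ∈ M, 1 / (M.card : ℝ) * val j ≤ U - (U - T) / (Fintype.card V : ℝ) := by
  classical
  have hpos : (0 : ℝ) < M.card := by exact_mod_cast Finset.card_pos.2 ⟨s, hs⟩
  have hle : (M.card : ℝ) ≤ Fintype.card V := by exact_mod_cast Finset.card_le_univ M
  have hsum : U - T ≤ ∑ j ∈ M, (U - val j) :=
    (sub_le_sub_left hT U).trans
      (Finset.single_le_sum (f := fun j => U - val j)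
        (fun j hj => sub_nonneg.2 (hU j hj)) hs)
  rw [Finset.sum_sub_distrib, Finset.sum_const, nsmul_eq_mul] at hsum
  rw [← Finset.mul_sum]
  have h1 : (U - T) / (Fintype.card V : ℝ) ≤ (U - T) / M.card :=
    div_le_div_of_nonneg_left (sub_nonneg.2 hTU) hpos hle
  have h2 : 1 / (M.card : ℝ) * ∑ j ∈ M, val j ≤ U - (U - T) / M.card := by
    rw [one_div_mul_eq_div, ← sub_nonneg]
    have : U - (U - T) / (M.card : ℝ) - (∑ j ∈ M, val j) / M.card =
        (M.card * U - ∑ j ∈ M, val j - (U - T)) / M.card := by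
      field_simp
      ring
    rw [this]
    exact div_nonneg (by linarith) hpos.le
  linarith

/-! ### Contraction of the spread in one coordinate -/

section Dynamics

variable {V : Type*} [Fintype V] [DecidableEq V] {d F : ℕ} {G : Digraph V} {A : Finset V}
  {f : V → EuclideanSpace ℝ (Fin d) → ℝ} {η : ℕ → ℝ} {xhat : EuclideanSpace ℝ (Fin d)}
  {x : ℕ → V → EuclideanSpace ℝ (Fin d)} {msg : ℕ → V → V → EuclideanSpace ℝ (Fin d)} {L : ℝ}

/-- One step of the dynamics in one signed component: the values stay below the maximum `U` up to
the gradient step, and a node that is itself below `T`, or has sufficiently many in-neighbours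
outside a set off which the regular values are below `T`, moves away from `U`. -/
theorem IsExecution.step_le (hexec : IsExecution G A F f η xhat x msg) (hlocal : IsLocalSet G F A)
    (hL : ∀ i x g, IsSubgradient (f i) x g → ‖g‖ ≤ L) (p : Fin d) (b : Bool) {k : ℕ}
    (hη : 0 ≤ η k) {U T : ℝ} (hU : ∀ j ∉ A, signOf b * x k j p ≤ U) (hTU : T ≤ U)
    {i : V} (hi : i ∉ A)
    (hT : signOf b * x k i p ≤ T ∨ ∃ S : Finset V, i ∈ S ∧
      (2 * d + 1) * F + 1 ≤ (inNeighbors G i \ S).card ∧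
      ∀ j ∉ A, j ∉ S → signOf b * x k j p ≤ T) :
    signOf b * x (k + 1) i p ≤ U - (U - T) / (Fintype.card V : ℝ) + L * η k := by
  obtain ⟨D, M, z, g, ⟨H, hH, rfl⟩, hM, rfl, hg, hx⟩ := hexec.update k i hi
  obtain ⟨W, hW, rfl⟩ := hM.exists_isHighest
  set N := (insert i (inNeighbors G i)).erase i with hN
  have hD : (insert i (inNeighbors G i) \ H).erase i = N \ H := by
    rw [hN, Finset.erase_sdiff_comm]
  simp only [hD] at hW
  have hNsub : N ⊆ inNeighbors G i := by
    rw [hN, Finset.erase_insert_eq_erase]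
    exact Finset.erase_subset _ _
  have hiN : i ∉ N := Finset.notMem_erase _ _
  have hself : msg k i i = x k i := hexec.broadcast k i hi i hi (Finset.mem_insert_self _ _)
  have hreg : ∀ j ∈ N, j ∉ A → msg k i j = x k j := fun j hj hjA =>
    hexec.broadcast k i hi j hjA (Finset.mem_insert_of_mem (hNsub hj))
  have hbyz : ∀ P ⊆ inNeighbors G i, (P ∩ A).card ≤ F := fun P hP =>
    (Finset.card_le_card (Finset.inter_subset_inter_right hP)).trans (hlocal i hi)
  have hiW : ∀ c, i ∉ W c := fun c h =>
    hiN (Finset.mem_sdiff.1 ((hW c.1 c.2).1 h)).1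
  have hiH : i ∉ H := fun h => hiN (hH.1 h)
  set M := (insert i (inNeighbors G i) \ H) \ Finset.univ.biUnion W
  have hiM : i ∈ M := by
    refine Finset.mem_sdiff.2 ⟨Finset.mem_sdiff.2 ⟨Finset.mem_insert_self _ _, hiH⟩, fun h => ?_⟩
    obtain ⟨c, -, hc⟩ := Finset.mem_biUnion.1 h
    exact hiW c hc
  have hMU : ∀ j ∈ M, signOf b * msg k i j p ≤ U := by
    intro j hj
    -- The node's own value bypasses the trims, but it is regular.
    by_cases hji : j = i
    · rw [hji, hself]
      exact hU i hi
    obtain ⟨hj, hjW⟩ := Finset.mem_sdiff.1 hj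
    have hjD : j ∈ N \ H := by
      rw [← hD]
      exact Finset.mem_erase.2 ⟨hji, hj⟩
    refine (hW b p).le_of_notMem (A := A) (hbyz _ (Finset.sdiff_subset.trans hNsub)) ?_ hjD
      fun h => hjW (Finset.mem_biUnion.2 ⟨(b, p), Finset.mem_univ _, h⟩)
    intro a ha haA
    rw [hreg a (Finset.mem_sdiff.1 ha).1 haA]
    exact hU a haA
  obtain ⟨s, hsM, hs⟩ : ∃ s ∈ M, signOf b * msg k i s p ≤ T := by
    rcases hT with hT | ⟨S, hiS, hcard, hS⟩
    · exact ⟨i, hiM, by rwa [hself]⟩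
    have hPN : inNeighbors G i \ S ⊆ N := by
      intro j hj
      obtain ⟨hj, hjS⟩ := Finset.mem_sdiff.1 hj
      refine Finset.mem_erase.2 ⟨?_, Finset.mem_insert_of_mem hj⟩
      rintro rfl
      exact hjS hiS
    obtain ⟨s, hs, hsT⟩ := exists_survivor_le (A := A) (W := W) (q := (b, p))
      (val := fun j => signOf b * msg k i j p) hH.card_le
      (fun c => (hW c.1 c.2).card_le) (hW b p) hPN (hbyz _ Finset.sdiff_subset)
      (by simpa [Fintype.card_prod] using hcard) (T := T) (by
        intro j hj hjA
        rw [hreg j (hPN hj) hjA]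
        exact hS j hjA (Finset.mem_sdiff.1 hj).2)
    exact ⟨s, Finset.sdiff_subset_sdiff
      (Finset.sdiff_subset_sdiff (Finset.erase_subset _ _) subset_rfl) subset_rfl hs, hsT⟩
  have havg := sum_div_card_le hMU hTU hsM hs
  have hval : signOf b * x (k + 1) i p =
      ∑ j ∈ M, 1 / (M.card : ℝ) * (signOf b * msg k i j p) - η k * (signOf b * g p) := by
    rw [hx, average]
    simp only [PiLp.sub_apply, PiLp.smul_apply, smul_eq_mul, WithLp.ofLp_sum, Finset.sum_apply,
      WithLp.ofLp_smul, Pi.smul_apply, mul_sub, Finset.mul_sum]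
    congr 1
    · exact Finset.sum_congr rfl fun j _ => by ring
    · ring
  have hgp : -(signOf b * g p) ≤ L := by
    have h1 : |g p| ≤ L := (PiLp.norm_apply_le g p).trans (hL i _ g hg)
    have h2 := abs_le.1 h1
    rcases b with _ | _ <;> simp [signOf] <;> linarith
  have := mul_le_mul_of_nonneg_right hgp hη
  rw [hval]
  linarith

/-- The largest value of a signed component over the regular nodes. -/
noncomputable def top (x : ℕ → V → EuclideanSpace ℝ (Fin d)) (hA : (Aᶜ : Finset V).Nonempty)
    (p : Fin d) (b : Bool) (k : ℕ) : ℝ :=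
  (Aᶜ : Finset V).sup' hA fun i => signOf b * x k i p

theorem le_top (hA : (Aᶜ : Finset V).Nonempty) (p : Fin d) (b : Bool) (k : ℕ) {i : V}
    (hi : i ∉ A) : signOf b * x k i p ≤ top x hA p b k :=
  Finset.le_sup' (fun i => signOf b * x k i p) (Finset.mem_compl.2 hi)

/-- Since `top` for `false` is minus the minimum, the sum of the two tops is the spread of the
component. -/
theorem sub_le_top_add_top (hA : (Aᶜ : Finset V).Nonempty) (p : Fin d) (k : ℕ) {i j : V}
    (hi : i ∉ A) (hj : j ∉ A) :
    x k i p - x k j p ≤ top x hA p true k + top x hA p false k := by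
  have h1 := le_top (x := x) hA p true k hi
  have h2 := le_top (x := x) hA p false k hj
  simp only [signOf, if_true, Bool.false_eq_true, if_false, one_mul, neg_mul] at h1 h2
  linarith

/-- The regular nodes whose signed component exceeds `c`. -/
noncomputable def exceeding (A : Finset V) (x : ℕ → V → EuclideanSpace ℝ (Fin d)) (p : Fin d)
    (b : Bool) (k : ℕ) (c : ℝ) : Finset V :=
  {i | i ∉ A ∧ c < signOf b * x k i p}

/-- The spread loses `δ / 2` scaled by `1 / n` once per step for `n` steps, while each of the two
extremes drifts outwards by at most `L * η k` per step. -/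
theorem IsExecution.top_add_top_le (hexec : IsExecution G A F f η xhat x msg)
    (hlocal : IsLocalSet G F A) (hrobust : IsRobust G ((2 * d + 1) * F + 1))
    (hL : ∀ i x g, IsSubgradient (f i) x g → ‖g‖ ≤ L) (hL0 : 0 ≤ L) (hη : ∀ k, 0 ≤ η k)
    (hanti : Antitone η) (hA : (Aᶜ : Finset V).Nonempty) (p : Fin d) (k : ℕ) :
    top x hA p true (k + Fintype.card V) + top x hA p false (k + Fintype.card V) ≤
      (1 - (1 / (Fintype.card V : ℝ)) ^ Fintype.card V / 2) *
        (top x hA p true k + top x hA p false k) + 2 * Fintype.card V * L * η k := by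
  set n := Fintype.card V with hn
  have hn1 : 1 ≤ n := Fintype.card_pos_iff.2 ⟨hA.choose⟩
  set α : ℝ := 1 / (n : ℝ) with hα
  have hα0 : 0 < α := one_div_pos.2 (by exact_mod_cast hn1)
  set δ := top x hA p true k + top x hA p false k with hδ
  have hδ0 : 0 ≤ δ := by
    have := sub_le_top_add_top (x := x) hA p k (Finset.mem_compl.1 hA.choose_spec)
      (Finset.mem_compl.1 hA.choose_spec)
    rwa [sub_self] at this
  set ε := L * η k with hε
  have hε' : ∀ s, L * η (k + s) ≤ ε := fun s =>
    mul_le_mul_of_nonneg_left (hanti (Nat.le_add_right k s)) hL0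
  -- Starting at `δ / 2` puts both thresholds at the midpoint of the range, so the two initial sets
  -- are disjoint. The ratio `1 / n` is the fraction of the gap to the bound that one averaging
  -- preserves.
  let θ : ℕ → ℝ := fun s => α ^ s * (δ / 2)
  have hθ0 : ∀ s, 0 ≤ θ s := fun s => mul_nonneg (pow_nonneg hα0.le s) (by linarith)
  let X : Bool → ℕ → Finset V := fun b s =>
    exceeding A x p b (k + s) (top x hA p b k + s * ε - θ s)
  have hmemX : ∀ b s i, i ∈ X b s ↔
      i ∉ A ∧ top x hA p b k + s * ε - θ s < signOf b * x (k + s) i p := fun b s i => by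
    simp [X, exceeding]
  have hbound : ∀ b s, ∀ j ∉ A, signOf b * x (k + s) j p ≤ top x hA p b k + s * ε := by
    intro b s
    induction s with
    | zero =>
      intro j hj
      simpa using le_top (x := x) hA p b k hj
    | succ s ih =>
      intro j hj
      -- Taking `T = U` leaves only the gradient drift.
      have := hexec.step_le hlocal hL p b (hη (k + s)) ih le_rfl hj (Or.inl (ih j hj))
      rw [sub_self, zero_div, sub_zero] at this
      push_cast
      have := hε' s
      rw [← add_assoc]
      linarith
  have hstep : ∀ b s, ∀ i ∉ A, (i ∉ X b s ∨ ∃ S : Finset V, i ∈ S ∧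
      (2 * d + 1) * F + 1 ≤ (inNeighbors G i \ S).card ∧ X b s ⊆ S) → i ∉ X b (s + 1) := by
    intro b s i hi h
    have hle : ∀ j ∉ A, j ∉ X b s → signOf b * x (k + s) j p ≤
        top x hA p b k + s * ε - θ s := fun j hj hjX => by
      by_contra! hlt
      exact hjX ((hmemX b s j).2 ⟨hj, hlt⟩)
    have key := hexec.step_le hlocal hL p b (hη (k + s)) (hbound b s)
      (T := top x hA p b k + s * ε - θ s) (by linarith [hθ0 s]) hi (by
        rcases h with h | ⟨S, h1, h2, h3⟩
        · exact Or.inl (hle i hi h)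
        · exact Or.inr ⟨S, h1, h2, fun j hj hjS => hle j hj fun h => hjS (h3 h)⟩)
    intro hmem
    have hlt := ((hmemX b (s + 1) i).1 hmem).2
    have hθs : θ (s + 1) = θ s / n := by
      simp only [θ, hα, pow_succ]
      ring
    rw [sub_sub_cancel, ← hn, ← hθs] at key
    push_cast at hlt
    rw [← add_assoc] at hlt
    linarith [hε' s]
  have hmono : ∀ b s, X b (s + 1) ⊆ X b s := by
    intro b s i hi
    by_contra h
    exact hstep b s i ((hmemX _ _ _).1 hi).1 (Or.inl h) hi
  have hdisj : ∀ s, Disjoint (X true s) (X false s) := by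
    intro s
    induction s with
    | zero =>
      rw [Finset.disjoint_left]
      intro i h1 h2
      have h1 := ((hmemX _ _ _).1 h1).2
      have h2 := ((hmemX _ _ _).1 h2).2
      simp only [signOf, θ, if_true, Bool.false_eq_true, if_false, Nat.cast_zero, zero_mul,
        pow_zero, one_mul, add_zero, neg_mul] at h1 h2
      linarith
    | succ s ih => exact ih.mono (hmono true s) (hmono false s)
  have hstrict : ∀ b s i, i ∈ X b s →
      (2 * d + 1) * F + 1 ≤ (inNeighbors G i \ X b s).card →
      (X b (s + 1)).card < (X b s).card := by
    intro b s i hi hcard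
    refine Finset.card_lt_card ⟨hmono b s, fun hsub => ?_⟩
    exact hstep b s i ((hmemX _ _ _).1 hi).1 (Or.inr ⟨X b s, hi, hcard, subset_rfl⟩) (hsub hi)
  -- While both sets are nonempty, robustness yields a node with enough in-neighbours outside its
  -- own set; that node leaves and, by `hmono`, none ever enters.
  have hcount : ∀ s, (∃ b, X b s = ∅) ∨ (X true s).card + (X false s).card + s ≤ n := by
    intro s
    induction s with
    | zero =>
      right
      rw [add_zero, ← Finset.card_union_of_disjoint (hdisj 0)]
      exact Finset.card_le_univ _
    | succ s ih =>
      rcases ih with ⟨b, hb⟩ | ih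
      · exact Or.inl ⟨b, Finset.subset_empty.1 (hb ▸ hmono b s)⟩
      by_cases ht : X true s = ∅
      · exact Or.inl ⟨true, Finset.subset_empty.1 (ht ▸ hmono true s)⟩
      by_cases hf : X false s = ∅
      · exact Or.inl ⟨false, Finset.subset_empty.1 (hf ▸ hmono false s)⟩
      right
      have h1 := Finset.card_le_card (hmono true s)
      have h2 := Finset.card_le_card (hmono false s)
      rcases hrobust _ _ (Finset.nonempty_iff_ne_empty.2 ht)
        (Finset.nonempty_iff_ne_empty.2 hf) (hdisj s) with ⟨i, hi, hr⟩ | ⟨i, hi, hr⟩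
      · have := hstrict true s i hi hr
        omega
      · have := hstrict false s i hi hr
        omega
  obtain ⟨b, hb⟩ : ∃ b, X b n = ∅ := by
    rcases hcount n with h | h
    · exact h
    · exact ⟨true, Finset.card_eq_zero.1 (by omega)⟩
  have hall : ∀ c, top x hA p c (k + n) ≤ top x hA p c k + n * ε := fun c =>
    Finset.sup'_le _ _ fun i hi => hbound c n i (Finset.mem_compl.1 hi)
  have hlow : top x hA p b (k + n) ≤ top x hA p b k + n * ε - θ n := by
    refine Finset.sup'_le _ _ fun i hi => ?_
    by_contra! hlt
    have := (hmemX b n i).2 ⟨Finset.mem_compl.1 hi, hlt⟩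
    simp [hb] at this
  have hθn : θ n = α ^ n * (δ / 2) := rfl
  have h1 := hall true
  have h2 := hall false
  rcases b with _ | _ <;> linarith

end Dynamics

/-! ### Passage to the limit -/

/-- A nonnegative sequence that contracts every `n` steps up to a vanishing error tends to zero. -/
theorem tendsto_zero_of_contraction {a e : ℕ → ℝ} {γ : ℝ} {n : ℕ} (hn : 0 < n) (hγ0 : 0 ≤ γ)
    (hγ1 : γ < 1) (ha : ∀ k, 0 ≤ a k) (he : Tendsto e atTop (𝓝 0))
    (h : ∀ k, a (k + n) ≤ γ * a k + e k) : Tendsto a atTop (𝓝 0) := by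
  rw [Metric.tendsto_atTop]
  intro ε hε
  -- With errors below this size, the level `ε / 2` is preserved by the recursion.
  have hpos : 0 < (1 - γ) * (ε / 2) := mul_pos (by linarith) (by linarith)
  obtain ⟨K, hK⟩ := eventually_atTop.1 (he.eventually_lt_const hpos)
  -- A common bound for the starting values of all `n` residue classes.
  set C := ∑ r ∈ Finset.range n, a (K + r) with hC
  have hind : ∀ j, ∀ r < n, a (K + r + n * j) ≤ ε / 2 + γ ^ j * C := by
    intro j
    induction j with
    | zero =>
      intro r hr
      have := Finset.single_le_sum (f := fun r => a (K + r)) (fun r _ => ha (K + r))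
        (Finset.mem_range.2 hr)
      simp only [mul_zero, add_zero, pow_zero, one_mul]
      linarith
    | succ j ih =>
      intro r hr
      have h1 := h (K + r + n * j)
      have h2 := mul_le_mul_of_nonneg_left (ih r hr) hγ0
      have h3 := hK (K + r + n * j) (by omega)
      rw [mul_add, mul_one, ← add_assoc, pow_succ]
      linarith
  have hlim : Tendsto (fun j => γ ^ j * C) atTop (𝓝 0) := by
    simpa using (tendsto_pow_atTop_nhds_zero_of_lt_one hγ0 hγ1).mul_const C
  obtain ⟨J, hJ⟩ := eventually_atTop.1 (hlim.eventually_lt_const (half_pos hε))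
  refine ⟨K + n * J, fun k hk => ?_⟩
  rw [Real.dist_eq, sub_zero, abs_of_nonneg (ha k)]
  have hdiv : J ≤ (k - K) / n := by
    rw [Nat.le_div_iff_mul_le hn, mul_comm]
    omega
  have hk' : K + (k - K) % n + n * ((k - K) / n) = k := by
    rw [add_assoc, Nat.mod_add_div]
    have : K ≤ k := (Nat.le_add_right _ _).trans hk
    omega
  have h1 := hind ((k - K) / n) ((k - K) % n) (Nat.mod_lt _ hn)
  rw [hk'] at h1
  linarith [hJ _ hdiv]

end ResilientOpt

theorem theorem1 {V : Type*} [Fintype V] [DecidableEq V] (d F : ℕ)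
    (G : Digraph V) (A : Finset V)
    (f : V → EuclideanSpace ℝ (Fin d) → ℝ)
    (hconv : ∀ i, ConvexOn ℝ Set.univ (f i))
    (hbdd : ∃ L : ℝ, 0 < L ∧ ∀ i x g, ResilientOpt.IsSubgradient (f i) x g → ‖g‖ ≤ L)
    (η : ℕ → ℝ) (hη_lim : Tendsto η atTop (𝓝 0)) (hη_anti : ∀ k, η (k + 1) < η k)
    (hη_sum : Tendsto (fun n => ∑ k ∈ Finset.range n, η k) atTop atTop)
    (hrobust : ResilientOpt.IsRobust G ((2 * d + 1) * F + 1))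
    (hlocal : ResilientOpt.IsLocalSet G F A)
    (xhat : EuclideanSpace ℝ (Fin d))
    (x : ℕ → V → EuclideanSpace ℝ (Fin d)) (msg : ℕ → V → V → EuclideanSpace ℝ (Fin d))
    (hexec : ResilientOpt.IsExecution G A F f η xhat x msg) :
    ∀ i ∉ A, ∀ j ∉ A, Tendsto (fun k => ‖x k i - x k j‖) atTop (𝓝 0) := by
  intro i hi j hj
  obtain ⟨L, hL0, hL⟩ := hbdd
  have hanti : Antitone η := antitone_nat_of_succ_le fun k => (hη_anti k).le
  -- A decreasing sequence stays above its limit.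
  have hη : ∀ k, 0 ≤ η k := fun k => hanti.le_of_tendsto hη_lim k
  have hA : (Aᶜ : Finset V).Nonempty := ⟨i, Finset.mem_compl.2 hi⟩
  have hn : 0 < Fintype.card V := Fintype.card_pos_iff.2 ⟨i⟩
  have hα0 : 0 < 1 / (Fintype.card V : ℝ) := one_div_pos.2 (by exact_mod_cast hn)
  have hα1 : 1 / (Fintype.card V : ℝ) ≤ 1 := by
    rw [div_le_one (by exact_mod_cast hn)]
    exact_mod_cast hn
  have hpow0 := pow_pos hα0 (Fintype.card V)
  have hpow1 := pow_le_one₀ (n := Fintype.card V) hα0.le hα1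
  have hdiam : ∀ p : Fin d,
      Tendsto (fun k => ResilientOpt.top x hA p true k + ResilientOpt.top x hA p false k) atTop (𝓝 0) := fun p =>
    ResilientOpt.tendsto_zero_of_contraction hn (by linarith) (by linarith)
      (fun k => by simpa using ResilientOpt.sub_le_top_add_top (x := x) hA p k hi hi)
      (by simpa using hη_lim.const_mul (2 * Fintype.card V * L))
      (hexec.top_add_top_le hlocal hrobust hL hL0.le hη hanti hA p)
  have hcoord : ∀ p : Fin d, Tendsto (fun k => (x k i - x k j) p) atTop (𝓝 0) := fun p =>
    squeeze_zero_norm (fun k => by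
      rw [Real.norm_eq_abs, abs_le, PiLp.sub_apply]
      have h1 := ResilientOpt.sub_le_top_add_top (x := x) hA p k hi hj
      have h2 := ResilientOpt.sub_le_top_add_top (x := x) hA p k hj hi
      constructor <;> linarith) (hdiam p)
  have hsum : Tendsto (fun k => √(∑ p, ‖(x k i - x k j) p‖ ^ 2)) atTop (𝓝 0) := by
    have := (tendsto_finsetSum Finset.univ fun p _ => (hcoord p).norm.pow 2).sqrt
    simpa using this
  simpa only [EuclideanSpace.norm_eq] using hsum
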